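/- A *Steiner 4-chain* consists of four pairwise distinct circles $\delta_1,\delta_2,\delta_3,\delta_4$ of positive radius in the Euclidean plane, together with two parent circles $\gamma,\Gamma$, where $\gamma$ has positive radius and lies in the open disk bounded by $\Gamma$, such that cyclically adjacent circles $\delta_i,\delta_{i+1}$ (indices mod 4) are externally tangent, every $\delta_i$ is externally tangent to $\gamma$, and every $\delta_i$ is internally tangent to $\Gamma$. Let $(r_1,r_2,r_3,r_4)$ be an ordered quadruple of positive real numbers, put $I_m=\sum_{i=1}^4 r_i^{-m}$ for $m=1,2,3$, and let $k\in\{1,2,3,4\}$. The quadruple *satisfies the feasibility test* (with neighbours checked at $r_k$) if there are real numbers $R>r>0$ (the virtual parent radii; there is at most one such pair) such that, with $a=1/r$ and $A=-1/R$: 1. $2(a+A)=I_1$ and $3A^2+10Aa+3a^2=2I_2$; 2. $R^2-6Rr+r^2>0$, and, with $d=\sqrt{R^2-6Rr+r^2}$, every $r_i$ lies in $\left[\frac{R-d-r}{2},\frac{R+d-r}{2}\right]$; 3. $I_3=\dfrac{5R^3-27R^2r+27Rr^2-5r^3}{4R^3r^3}$; 4. with $u=r_k$, the reciprocals of the two real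 roots, counted with multiplicity, of the quadratic trinomial $$4R^2r^2u^2\,x^2-4Rru^2(R-r)\,x+[2Rr-(R-r)u]^2+4Rru^2$$ are, in some order, the two radii $r_{k-1},r_{k+1}$ (indices mod 4). **Theorem.** For every quadruple of positive numbers $(r_1,r_2,r_3,r_4)$ and every $k$: (i) there is a Steiner 4-chain with non-concentric parent circles whose circles $\delta_1,\dots,\delta_4$ have radii $r_1,\dots,r_4$ in this order if and only if the quadruple satisfies the feasibility test; (ii) there is a Steiner 4-chain (with concentric parents allowed) whose circles have radii $r_1,\dots,r_4$ in this order if and only if the quadruple satisfies the feasibility test with the strict inequality in 2 replaced by $R^2-6Rr+r^2\ge 0$. -/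

import Mathlib

open EuclideanGeometry

/-- The Euclidean plane. -/
abbrev Plane : Type := EuclideanSpace ℝ (Fin 2)

/-- The circles `δ 0, …, δ (n - 1)` form a Steiner `n`-chain with inner parent circle `γ` and outer
parent circle `Γ`. Indices are taken modulo `n`. Circles are Mathlib spheres of the plane; as these
may have a non-positive radius, positivity is required here (for `Γ` it follows from `nested`). -/
structure IsSteinerChain {n : ℕ} [NeZero n] (γ Γ : Sphere Plane) (δ : Fin n → Sphere Plane) :
    Prop where
  inner_pos : 0 < γ.radius
  nested : (γ : Set Plane) ⊆ Metric.ball Γ.center Γ.radius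
  radius_pos : ∀ i, 0 < (δ i).radius
  distinct : Function.Injective δ
  tangent_next : ∀ i, (δ i).IsExtTangent (δ (i + 1))
  tangent_inner : ∀ i, (δ i).IsExtTangent γ
  tangent_outer : ∀ i, (δ i).IsIntTangent Γ

/-- The `k`-th moment of curvatures of a quadruple of radii. -/
noncomputable def curvatureMoment (k : ℕ) (ρ : Fin 4 → ℝ) : ℝ := ∑ i, (1 / ρ i) ^ k

/-- `R > r > 0` are the virtual parent radii of the quadruple `ρ`: their signed curvatures
`A = -1/R` and `a = 1/r` solve `2(a + A) = I₁`, `3A² + 10Aa + 3a² = 2I₂`. -/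
structure IsVirtualRadii (ρ : Fin 4 → ℝ) (R r : ℝ) : Prop where
  inner_pos : 0 < r
  inner_lt_outer : r < R
  first_moment : 2 * (1 / r + -1 / R) = curvatureMoment 1 ρ
  second_moment :
    3 * (-1 / R) ^ 2 + 10 * (-1 / R) * (1 / r) + 3 * (1 / r) ^ 2 = 2 * curvatureMoment 2 ρ

/-- A quadruple has at most one pair of virtual parent radii. -/
theorem IsVirtualRadii.unique {ρ : Fin 4 → ℝ} {R r R' r' : ℝ} (h : IsVirtualRadii ρ R r)
    (h' : IsVirtualRadii ρ R' r') : R = R' ∧ r = r' := by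
  obtain ⟨hr, hR, h1, h2⟩ := h
  obtain ⟨hr', hR', h1', h2'⟩ := h'
  have hR0 : 0 < R := hr.trans hR
  have hR0' : 0 < R' := hr'.trans hR'
  have ha : 0 < 1 / r := by positivity
  have ha' : 0 < 1 / r' := by positivity
  have hA : -1 / R < 0 := div_neg_of_neg_of_pos (by norm_num) hR0
  have hA' : -1 / R' < 0 := div_neg_of_neg_of_pos (by norm_num) hR0'
  have hs : 1 / r + -1 / R = 1 / r' + -1 / R' := by linarith
  have key : (1 / r - 1 / r') * (1 / r - -1 / R') = 0 := by
    have e : -1 / R = 1 / r' + -1 / R' - 1 / r := by linarith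
    rw [e] at h2
    linear_combination (h2' - h2) / 4
  have haa : 1 / r = 1 / r' := by
    rcases mul_eq_zero.1 key with h | h <;> linarith
  have hAA : -1 / R = -1 / R' := by linarith
  have e1 : r = r' := by simpa using haa
  refine ⟨?_, e1⟩
  rw [neg_div, neg_div, neg_inj] at hAA
  simpa using hAA

/-- The square of the distance between the centres of the parent circles that is prescribed by the
Pedoe relation for `n = 4`: `(R - r)² - 4Rr = R² - 6Rr + r²`. -/
def pedoe (R r : ℝ) : ℝ := R ^ 2 - 6 * R * r + r ^ 2

/-- The range `[r_*, r^*] = [(R - d - r)/2, (R + d - r)/2]` of the poristic radii, where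
`d = √(R² - 6Rr + r²)`. -/
noncomputable def poristicRange (R r : ℝ) : Set ℝ :=
  Set.Icc ((R - √(pedoe R r) - r) / 2) ((R + √(pedoe R r) - r) / 2)

/-- The third virtual moment of curvatures. -/
noncomputable def virtualThirdMoment (R r : ℝ) : ℝ :=
  (5 * R ^ 3 - 27 * R ^ 2 * r + 27 * R * r ^ 2 - 5 * r ^ 3) / (4 * R ^ 3 * r ^ 3)

/-- Yiu's quadratic trinomial for `n = 4`; its roots are the curvatures of the two neighbours of
a poristic circle of radius `u`. -/
noncomputable def yiuTrinomial (R r u : ℝ) : Polynomial ℝ :=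
  Polynomial.C (4 * R ^ 2 * r ^ 2 * u ^ 2) * Polynomial.X ^ 2
    + Polynomial.C (-4 * R * r * u ^ 2 * (R - r)) * Polynomial.X
    + Polynomial.C ((2 * R * r - (R - r) * u) ^ 2 + 4 * R * r * u ^ 2)

/-- The radii (with multiplicity) of the neighbours of a poristic circle of radius `u`. -/
noncomputable def neighbourRadii (R r u : ℝ) : Multiset ℝ :=
  (yiuTrinomial R r u).roots.map fun x => 1 / x

/-- The checks of the feasibility test other than the sign of the Pedoe expression, for the virtual
parent radii `R, r`; the neighbours are checked at the circle with index `k`. -/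
structure PassesChecks (ρ : Fin 4 → ℝ) (k : Fin 4) (R r : ℝ) : Prop where
  range : ∀ i, ρ i ∈ poristicRange R r
  third_moment : curvatureMoment 3 ρ = virtualThirdMoment R r
  neighbours : neighbourRadii R r (ρ k) = {ρ (k - 1), ρ (k + 1)}

/-- The feasibility test, with neighbours checked at the circle with index `k`. -/
def FeasibilityTest (ρ : Fin 4 → ℝ) (k : Fin 4) : Prop :=
  ∃ R r : ℝ, IsVirtualRadii ρ R r ∧ 0 < pedoe R r ∧ PassesChecks ρ k R r

/-- The variant of the feasibility test that also admits concentric virtual parent circles. -/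
def FeasibilityTestWithConcentric (ρ : Fin 4 → ℝ) (k : Fin 4) : Prop :=
  ∃ R r : ℝ, IsVirtualRadii ρ R r ∧ 0 ≤ pedoe R r ∧ PassesChecks ρ k R r

/-! Chains and tests meet in `IsPoristicQuadruple`. Put the inner centre at the origin, let `D` be
the squared distance of the parent centres, and scale each centre by its curvature. The two parent
tangencies place the points (curvature, transverse coordinate) on an ellipse, and tangency of
neighbours prescribes the polarized form of consecutive points. Closing after four steps with
distinct opposite circles forces right angles (`quarter_turn`). This yields the Pedoe relation, the
sums of opposite curvatures and the sum of squared deviations; when `D = 0` all radii agree and the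
same lemma applies to the centres. Conversely, a poristic quadruple parametrizes four quarter turns,
from which the centres are rebuilt. On the test side, Vieta's formulas for Yiu's trinomial together
with the first moment are equivalent to the poristic relations, and these imply the other checks. -/

/-! ### Closed quadrilaterals of equal vectors -/

/-- Two distinct vectors of equal length that are both orthogonal to a nonzero vector of the plane
with quadratic form `n s² + Y²` are opposite. -/
lemma opposite_of_orthogonal {n σ a b s₁ Y₁ s₃ Y₃ : ℝ} (hn : 0 < n)
    (hab : ¬(a = 0 ∧ b = 0)) (h₁ : n * s₁ ^ 2 + Y₁ ^ 2 = σ) (h₃ : n * s₃ ^ 2 + Y₃ ^ 2 = σ)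
    (ho₁ : n * a * s₁ + b * Y₁ = 0) (ho₃ : n * a * s₃ + b * Y₃ = 0)
    (hne : ¬(s₁ = s₃ ∧ Y₁ = Y₃)) : s₁ + s₃ = 0 ∧ Y₁ + Y₃ = 0 := by
  have hdet : s₁ * Y₃ - s₃ * Y₁ = 0 := by
    by_contra hd
    apply hab
    constructor
    · have h : (n * a) * (s₁ * Y₃ - s₃ * Y₁) = 0 := by linear_combination Y₃ * ho₁ - Y₁ * ho₃
      have := (mul_eq_zero.1 h).resolve_right hd
      exact (mul_eq_zero.1 this).resolve_left hn.ne'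
    · have h : b * (s₁ * Y₃ - s₃ * Y₁) = 0 := by linear_combination s₁ * ho₃ - s₃ * ho₁
      exact (mul_eq_zero.1 h).resolve_right hd
  have definite : ∀ x y : ℝ, n * x ^ 2 + y ^ 2 = 0 → x = 0 ∧ y = 0 := by
    intro x y h
    have hx : 0 ≤ n * x ^ 2 := by positivity
    have hy := sq_nonneg y
    have hx0 : n * x ^ 2 = 0 := by linarith
    have hy0 : y ^ 2 = 0 := by linarith
    exact ⟨by simpa [hn.ne'] using hx0, by simpa using hy0⟩
  -- Lagrange's identity: as the determinant vanishes, the inner product of the two vectors is `σ`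
  -- or `-σ`, so they are equal or opposite.
  have hprod : (σ - (n * s₁ * s₃ + Y₁ * Y₃)) * (σ + (n * s₁ * s₃ + Y₁ * Y₃)) = 0 := by
    linear_combination (-σ) * h₁ - (n * s₁ ^ 2 + Y₁ ^ 2) * h₃
      + n * (s₁ * Y₃ - s₃ * Y₁) * hdet
  rcases mul_eq_zero.1 hprod with h | h
  · exact absurd ⟨by linarith [(definite (s₁ - s₃) (Y₁ - Y₃)
      (by linear_combination h₁ + h₃ + 2 * h)).1], by linarith [(definite (s₁ - s₃) (Y₁ - Y₃)
      (by linear_combination h₁ + h₃ + 2 * h)).2]⟩ hne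
  · exact definite _ _ (by linear_combination h₁ + h₃ + 2 * h)

/-- A closed quadrilateral of vectors of equal length in the plane with quadratic form
`n s² + Y²`, with equal products of consecutive vectors and with distinct opposite vectors,
turns by a right angle at each step. -/
lemma quarter_turn {n κ σ : ℝ} {s Y : Fin 4 → ℝ} (hn : 0 < n)
    (hs : ∀ i, n * s i ^ 2 + Y i ^ 2 = σ)
    (hp : ∀ i, n * s i * s (i + 1) + Y i * Y (i + 1) = κ)
    (h02 : ¬(s 0 = s 2 ∧ Y 0 = Y 2)) (h13 : ¬(s 1 = s 3 ∧ Y 1 = Y 3)) :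
    κ = 0 ∧ s 0 + s 2 = 0 ∧ s 1 + s 3 = 0 ∧ n * (s 0 ^ 2 + s 1 ^ 2) = σ := by
  have p0 := hp 0
  have p1 := hp 1
  have p2 := hp 2
  have p3 := hp 3
  simp only [zero_add, show (1 : Fin 4) + 1 = 2 from rfl, show (2 : Fin 4) + 1 = 3 from rfl,
    show (3 : Fin 4) + 1 = 0 from rfl] at p0 p1 p2 p3
  -- Equal consecutive products make each diagonal difference orthogonal to both vectors of the
  -- other pair.
  obtain ⟨e1, f1⟩ := opposite_of_orthogonal (a := s 0 - s 2) (b := Y 0 - Y 2) hn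
    (by rwa [sub_eq_zero, sub_eq_zero]) (hs 1) (hs 3)
    (by linear_combination p0 - p1) (by linear_combination p3 - p2) h13
  obtain ⟨e0, f0⟩ := opposite_of_orthogonal (a := s 1 - s 3) (b := Y 1 - Y 3) hn
    (by rwa [sub_eq_zero, sub_eq_zero]) (hs 0) (hs 2)
    (by linear_combination p0 - p3) (by linear_combination p1 - p2) h02
  have hκ : κ = 0 := by linear_combination (-p0 - p3 + n * s 0 * e1 + Y 0 * f1) / 2
  refine ⟨hκ, e0, e1, ?_⟩
  have hσ : σ ≠ 0 := by
    intro h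
    apply h02
    have h0 := hs 0
    have hx : 0 ≤ n * s 0 ^ 2 := by positivity
    have hy := sq_nonneg (Y 0)
    have hx0 : n * s 0 ^ 2 = 0 := by linarith
    have hy0 : Y 0 ^ 2 = 0 := by linarith
    have hs0 : s 0 = 0 := by simpa [hn.ne'] using hx0
    have hY0 : Y 0 = 0 := by simpa using hy0
    constructor <;> linarith
  -- Two orthogonal vectors of equal length are, up to scale, the rows of an orthogonal matrix; its
  -- first column has the same length.
  have h : σ * (n * (s 0 ^ 2 + s 1 ^ 2) - σ) = 0 := by
    rw [hκ] at p0
    linear_combination (n * s 0 * s 1 - Y 0 * Y 1) * p0 - (n * s 0 ^ 2 - σ) * (hs 1)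
      + Y 1 ^ 2 * hs 0
  linarith [(mul_eq_zero.1 h).resolve_left hσ]

/-! ### Poristic quadruples and the feasibility checks -/

/-- The algebraic description of the radii of Steiner 4-chains with parent radii `R, r`: opposite
curvatures have sum `1/r - 1/R`, and the deviations of two consecutive curvatures from half of that
are the coordinates of a point of a circle whose radius is prescribed by `pedoe R r`. -/
structure IsPoristicQuadruple (ρ : Fin 4 → ℝ) (R r : ℝ) : Prop where
  inner_pos : 0 < r
  inner_lt_outer : r < R
  opp_zero : 1 / ρ 0 + 1 / ρ 2 = (R - r) / (R * r)
  opp_one : 1 / ρ 1 + 1 / ρ 3 = (R - r) / (R * r)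
  deviation : (1 / ρ 0 - (R - r) / (2 * R * r)) ^ 2 + (1 / ρ 1 - (R - r) / (2 * R * r)) ^ 2
    = pedoe R r / (4 * R ^ 2 * r ^ 2)

lemma IsPoristicQuadruple.pedoe_nonneg {ρ : Fin 4 → ℝ} {R r : ℝ}
    (h : IsPoristicQuadruple ρ R r) : 0 ≤ pedoe R r := by
  have hr := h.inner_pos
  have hR : 0 < R := hr.trans h.inner_lt_outer
  have hd := h.deviation
  have h1 : 0 ≤ pedoe R r / (4 * R ^ 2 * r ^ 2) := by rw [← hd]; positivity
  by_contra hneg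
  have : pedoe R r / (4 * R ^ 2 * r ^ 2) < 0 := div_neg_of_neg_of_pos (not_le.1 hneg) (by positivity)
  linarith

lemma IsPoristicQuadruple.opp {ρ : Fin 4 → ℝ} {R r : ℝ} (h : IsPoristicQuadruple ρ R r)
    (i : Fin 4) : 1 / ρ i + 1 / ρ (i + 2) = (R - r) / (R * r) := by
  have h0 := h.opp_zero
  have h1 := h.opp_one
  fin_cases i
  · exact h0
  · exact h1
  · exact (add_comm _ _).trans h0
  · exact (add_comm _ _).trans h1

lemma IsPoristicQuadruple.deviation_next {ρ : Fin 4 → ℝ} {R r : ℝ}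
    (h : IsPoristicQuadruple ρ R r) (i : Fin 4) :
    (1 / ρ i - (R - r) / (2 * R * r)) ^ 2 + (1 / ρ (i + 1) - (R - r) / (2 * R * r)) ^ 2
      = pedoe R r / (4 * R ^ 2 * r ^ 2) := by
  have hr := h.inner_pos
  have hR : 0 < R := hr.trans h.inner_lt_outer
  have e : (R - r) / (R * r) = 2 * ((R - r) / (2 * R * r)) := by field_simp
  have h0 := h.opp_zero
  have h1 := h.opp_one
  have hd := h.deviation
  rw [e] at h0 h1
  have e2 : 1 / ρ 2 = 2 * ((R - r) / (2 * R * r)) - 1 / ρ 0 := by linarith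
  have e3 : 1 / ρ 3 = 2 * ((R - r) / (2 * R * r)) - 1 / ρ 1 := by linarith
  rw [← hd]
  fin_cases i
  · rfl
  · change (1 / ρ 1 - _) ^ 2 + (1 / ρ 2 - _) ^ 2 = _
    rw [e2]; ring
  · change (1 / ρ 2 - _) ^ 2 + (1 / ρ 3 - _) ^ 2 = _
    rw [e2, e3]; ring
  · change (1 / ρ 3 - _) ^ 2 + (1 / ρ 0 - _) ^ 2 = _
    rw [e3]; ring

/-- Vieta's formulas, divided through by the leading coefficient. -/
lemma neighbourRadii_eq_pair_iff {R r u v w : ℝ} (hR : R ≠ 0) (hr : r ≠ 0) (hu : u ≠ 0)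
    (hv : v ≠ 0) (hw : w ≠ 0) :
    neighbourRadii R r u = {v, w} ↔ 1 / v + 1 / w = (R - r) / (R * r) ∧
      1 / v * (1 / w) = (1 / u - (R - r) / (2 * R * r)) ^ 2 + 1 / (R * r) := by
  have hinv : Function.Injective fun x : ℝ => 1 / x := fun x y h => by simpa using h
  have h1 : neighbourRadii R r u = {v, w} ↔ (yiuTrinomial R r u).roots = {1 / v, 1 / w} := by
    rw [neighbourRadii, ← (Multiset.map_injective hinv).eq_iff (b := {1 / v, 1 / w})]
    simp
  rw [h1, yiuTrinomial, Polynomial.roots_quadratic_eq_pair_iff_of_ne_zero (by positivity)]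
  refine and_congr ?_ ?_
  · constructor <;> intro h
    · field_simp
      field_simp at h
      linarith
    · field_simp
      field_simp at h
      linarith
  · constructor <;> intro h
    · field_simp
      field_simp at h
      linarith
    · field_simp
      field_simp at h
      linarith

lemma sum_curvature_add_opp (b : Fin 4 → ℝ) (k : Fin 4) :
    ∑ i, b i = (b k + b (k + 2)) + (b (k - 1) + b (k + 1)) := by
  rw [Fin.sum_univ_four]
  fin_cases k
  · change _ = (b 0 + b 2) + (b 3 + b 1); ring
  · change _ = (b 1 + b 3) + (b 0 + b 2); ring
  · change _ = (b 2 + b 0) + (b 1 + b 3); ring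
  · change _ = (b 3 + b 1) + (b 2 + b 0); ring

/-- The checks at one circle determine a poristic quadruple. -/
lemma isPoristicQuadruple_of_neighbours {ρ : Fin 4 → ℝ} (hρ : ∀ i, 0 < ρ i) {k : Fin 4} {R r : ℝ}
    (hv : IsVirtualRadii ρ R r) (hn : neighbourRadii R r (ρ k) = {ρ (k - 1), ρ (k + 1)}) :
    IsPoristicQuadruple ρ R r := by
  obtain ⟨hr, hrR, h1, -⟩ := hv
  have hR : 0 < R := hr.trans hrR
  obtain ⟨hs, hp⟩ := (neighbourRadii_eq_pair_iff hR.ne' hr.ne' (hρ k).ne' (hρ _).ne'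
    (hρ _).ne').1 hn
  have e : (R - r) / (R * r) = 2 * ((R - r) / (2 * R * r)) := by field_simp
  have e' : 1 / r + -1 / R = 2 * ((R - r) / (2 * R * r)) := by field_simp; ring
  have eD : ((R - r) / (2 * R * r)) ^ 2 - 1 / (R * r) = pedoe R r / (4 * R ^ 2 * r ^ 2) := by
    rw [pedoe]; field_simp; ring
  simp only [curvatureMoment, pow_one] at h1
  rw [sum_curvature_add_opp _ k, e'] at h1
  have ho : 1 / ρ k + 1 / ρ (k + 2) = (R - r) / (R * r) := by linarith
  rw [e] at hs ho
  set β := (R - r) / (2 * R * r) with hβ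
  -- The neighbours' curvatures are symmetric about `β`, so their product is `β ^ 2` minus the
  -- squared deviation of either one.
  have hd : (1 / ρ k - β) ^ 2 + (1 / ρ (k + 1) - β) ^ 2 = pedoe R r / (4 * R ^ 2 * r ^ 2) := by
    rw [← eD]
    linear_combination -hp + (1 / ρ (k + 1)) * hs
  suffices 1 / ρ 0 + 1 / ρ 2 = 2 * β ∧ 1 / ρ 1 + 1 / ρ 3 = 2 * β ∧
      (1 / ρ 0 - β) ^ 2 + (1 / ρ 1 - β) ^ 2 = pedoe R r / (4 * R ^ 2 * r ^ 2) from
    ⟨hr, hrR, this.1.trans e.symm, this.2.1.trans e.symm, this.2.2⟩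
  rw [← hd]
  fin_cases k
  · change 1 / ρ 3 + 1 / ρ 1 = _ at hs
    exact ⟨ho, (add_comm _ _).trans hs, rfl⟩
  · change 1 / ρ 0 + 1 / ρ 2 = _ at hs
    change 1 / ρ 1 + 1 / ρ 3 = _ at ho
    refine ⟨hs, ho, ?_⟩
    change _ = (1 / ρ 1 - β) ^ 2 + (1 / ρ 2 - β) ^ 2
    rw [← sub_eq_iff_eq_add'.2 hs.symm]; ring
  · change 1 / ρ 1 + 1 / ρ 3 = _ at hs
    change 1 / ρ 2 + 1 / ρ 0 = _ at ho
    refine ⟨(add_comm _ _).trans ho, hs, ?_⟩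
    change _ = (1 / ρ 2 - β) ^ 2 + (1 / ρ 3 - β) ^ 2
    rw [← sub_eq_iff_eq_add'.2 hs.symm, ← sub_eq_iff_eq_add.2 ho.symm]; ring
  · change 1 / ρ 2 + 1 / ρ 0 = _ at hs
    change 1 / ρ 3 + 1 / ρ 1 = _ at ho
    refine ⟨(add_comm _ _).trans hs, (add_comm _ _).trans ho, ?_⟩
    change _ = (1 / ρ 3 - β) ^ 2 + (1 / ρ 0 - β) ^ 2
    rw [← sub_eq_iff_eq_add.2 ho.symm]; ring

lemma IsPoristicQuadruple.mem_poristicRange {ρ : Fin 4 → ℝ} (hρ : ∀ i, 0 < ρ i) {R r : ℝ}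
    (h : IsPoristicQuadruple ρ R r) (i : Fin 4) : ρ i ∈ poristicRange R r := by
  have hr := h.inner_pos
  have hR : 0 < R := hr.trans h.inner_lt_outer
  have hD := h.pedoe_nonneg
  have hd := h.deviation_next i
  have hu := hρ i
  have h1 : (1 / ρ i - (R - r) / (2 * R * r)) ^ 2 ≤ pedoe R r / (4 * R ^ 2 * r ^ 2) := by
    rw [← hd]; linarith [sq_nonneg (1 / ρ (i + 1) - (R - r) / (2 * R * r))]
  have h2 : (2 * ρ i - (R - r)) ^ 2 ≤ pedoe R r := by
    have e1 : (1 / ρ i - (R - r) / (2 * R * r)) ^ 2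
        = (2 * R * r - (R - r) * ρ i) ^ 2 / (4 * R ^ 2 * r ^ 2 * ρ i ^ 2) := by
      field_simp; ring
    rw [e1, div_le_div_iff₀ (by positivity) (by positivity)] at h1
    -- For `u = ρ i`, both the curvature bound and the radius bound amount to `u ^ 2 - (R - r) * u +
    -- R * r ≤ 0`.
    have h3 : 0 ≤ (4 * R ^ 2 * r ^ 2 * (4 * R * r)) * (pedoe R r - (2 * ρ i - (R - r)) ^ 2) := by
      rw [pedoe] at h1 ⊢
      nlinarith
    have h4 := nonneg_of_mul_nonneg_right h3 (by positivity)
    linarith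
  have h3 := abs_le.1 (Real.abs_le_sqrt h2)
  constructor <;> linarith [h3.1, h3.2]

/-- The curvatures are `β ± s` and `β ± t` with `β = (R - r) / (2 * R * r)`, so the first three
moments depend only on `β` and `s ^ 2 + t ^ 2`. -/
lemma IsPoristicQuadruple.checks {ρ : Fin 4 → ℝ} (hρ : ∀ i, 0 < ρ i) {R r : ℝ}
    (h : IsPoristicQuadruple ρ R r) (k : Fin 4) :
    IsVirtualRadii ρ R r ∧ PassesChecks ρ k R r := by
  have hr := h.inner_pos
  have hR : 0 < R := hr.trans h.inner_lt_outer
  have e : (R - r) / (R * r) = 2 * ((R - r) / (2 * R * r)) := by field_simp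
  have eD : pedoe R r / (4 * R ^ 2 * r ^ 2) = ((R - r) / (2 * R * r)) ^ 2 - 1 / (R * r) := by
    rw [pedoe]; field_simp; ring
  have h0 := h.opp_zero
  have h1 := h.opp_one
  have hd := h.deviation
  rw [e] at h0 h1
  rw [eD] at hd
  have e2 : 1 / ρ 2 = 2 * ((R - r) / (2 * R * r)) - 1 / ρ 0 := by linarith
  have e3 : 1 / ρ 3 = 2 * ((R - r) / (2 * R * r)) - 1 / ρ 1 := by linarith
  refine ⟨⟨hr, h.inner_lt_outer, ?_, ?_⟩, ⟨h.mem_poristicRange hρ, ?_, ?_⟩⟩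
  · rw [curvatureMoment, Fin.sum_univ_four, e2, e3]
    field_simp
    ring
  · rw [curvatureMoment, Fin.sum_univ_four, e2, e3]
    have : 3 * (-1 / R) ^ 2 + 10 * (-1 / R) * (1 / r) + 3 * (1 / r) ^ 2
        = 12 * ((R - r) / (2 * R * r)) ^ 2 - 4 * (1 / (R * r)) := by
      field_simp; ring
    rw [this]
    linear_combination (-4) * hd
  · have : virtualThirdMoment R r = 10 * ((R - r) / (2 * R * r)) ^ 3
        - 6 * ((R - r) / (2 * R * r)) * (1 / (R * r)) := by
      rw [virtualThirdMoment]; field_simp; ring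
    rw [this, curvatureMoment, Fin.sum_univ_four, e2, e3]
    linear_combination 6 * ((R - r) / (2 * R * r)) * hd
  · rw [neighbourRadii_eq_pair_iff hR.ne' hr.ne' (hρ k).ne' (hρ _).ne' (hρ _).ne']
    have ho := h.opp (k - 1)
    have hk := h.deviation_next k
    rw [show k - 1 + 2 = k + 1 from (by decide : ∀ j : Fin 4, j - 1 + 2 = j + 1) k] at ho
    refine ⟨ho, ?_⟩
    rw [e] at ho
    rw [eD] at hk
    linear_combination -hk + (1 / ρ (k + 1)) * ho

/-! ### From chains to poristic quadruples -/

/-- The distances in a Steiner 4-chain, in coordinates with the centre of the inner parent circle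
as origin and the centre of the outer parent circle at `(a, b)`. -/
structure IsChainCoordinates (ρ x y : Fin 4 → ℝ) (R r a b : ℝ) : Prop where
  inner_pos : 0 < r
  inner_lt_outer : r < R
  nested : a ^ 2 + b ^ 2 < (R - r) ^ 2
  radius_pos : ∀ i, 0 < ρ i
  inner : ∀ i, x i ^ 2 + y i ^ 2 = (ρ i + r) ^ 2
  outer : ∀ i, (x i - a) ^ 2 + (y i - b) ^ 2 = (R - ρ i) ^ 2
  next : ∀ i, (x i - x (i + 1)) ^ 2 + (y i - y (i + 1)) ^ 2 = (ρ i + ρ (i + 1)) ^ 2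
  distinct : ∀ i j, i ≠ j → ¬(x i = x j ∧ y i = y j ∧ ρ i = ρ j)

lemma IsChainCoordinates.concentric {ρ x y : Fin 4 → ℝ} {R r a b : ℝ}
    (h : IsChainCoordinates ρ x y R r a b) (h0 : a ^ 2 + b ^ 2 = 0) :
    pedoe R r = 0 ∧ IsPoristicQuadruple ρ R r := by
  obtain ⟨hr, hrR, hn, hρ, hi, ho, ht, hne⟩ := h
  have hR : 0 < R := hr.trans hrR
  have ha : a = 0 := by nlinarith [sq_nonneg a, sq_nonneg b]
  have hb : b = 0 := by nlinarith [sq_nonneg a, sq_nonneg b]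
  subst ha hb
  simp only [sub_zero] at ho
  have hu : ∀ i, ρ i = (R - r) / 2 := by
    intro i
    have : (R + r) * (R - r - 2 * ρ i) = 0 := by linear_combination hi i - ho i
    have := (mul_eq_zero.1 this).resolve_left (by positivity)
    linarith
  obtain ⟨hκ, -, -, -⟩ := quarter_turn (n := 1) (s := x) (Y := y)
    (σ := ((R + r) / 2) ^ 2) (κ := ((R + r) / 2) ^ 2 - (R - r) ^ 2 / 2) one_pos
    (fun i => by rw [one_mul, hi, hu]; ring)
    (fun i => by
      have h1 := ht i
      have h2 := hi i
      have h3 := hi (i + 1)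
      simp only [hu] at h1 h2 h3
      linear_combination (h2 + h3 - h1) / 2)
    (fun h => hne 0 2 (by decide) ⟨h.1, h.2, by rw [hu, hu]⟩)
    (fun h => hne 1 3 (by decide) ⟨h.1, h.2, by rw [hu, hu]⟩)
  have hp : pedoe R r = 0 := by rw [pedoe]; linear_combination (-4) * hκ
  have hRr : R - r ≠ 0 := by linarith
  have hβ : 1 / ((R - r) / 2) = (R - r) / (2 * R * r) := by
    rw [pedoe] at hp
    field_simp
    linear_combination -hp
  refine ⟨hp, hr, hrR, ?_, ?_, ?_⟩
  · rw [hu, hu, hβ]; field_simp; norm_num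
  · rw [hu, hu, hβ]; field_simp; norm_num
  · rw [hu, hu, hβ, hp]; simp

lemma IsChainCoordinates.eccentric {ρ x y : Fin 4 → ℝ} {R r a b : ℝ}
    (h : IsChainCoordinates ρ x y R r a b) (h0 : 0 < a ^ 2 + b ^ 2) :
    a ^ 2 + b ^ 2 = pedoe R r ∧ IsPoristicQuadruple ρ R r := by
  obtain ⟨hr, hrR, hn, hρ, hi, ho, ht, hne⟩ := h
  have hR : 0 < R := hr.trans hrR
  set D := a ^ 2 + b ^ 2 with hD
  have hq : 0 < (R - r) ^ 2 - D := by linarith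
  have hq' : 0 < (R + r) ^ 2 - D := by nlinarith [mul_pos hR hr]
  have hdot : ∀ i, a * x i + b * y i = (D + r ^ 2 - R ^ 2 + 2 * (R + r) * ρ i) / 2 := by
    intro i
    linear_combination (hi i - ho i) / 2
  have hc : ∀ i, ρ i * (1 / ρ i) = 1 := fun i => mul_one_div_cancel (hρ i).ne'
  -- the coordinates along the line of centres and across it, scaled by the curvature
  have hX : ∀ i, (a * x i + b * y i) * (1 / ρ i)
      = (D + r ^ 2 - R ^ 2) / 2 * (1 / ρ i) + (R + r) := by
    intro i
    rw [hdot]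
    linear_combination (R + r) * hc i
  have hq0 := hq.ne'
  -- Substituting `hX` into X² + Y² = D(1 + r/ρ)² and completing the square gives an ellipse with
  -- centre `β` and leading coefficient `n`; `κ + 2 * D` is its constant, and `κ` that of the
  -- polarized relation.
  set β := 2 * (R - r) / ((R - r) ^ 2 - D) with hβ
  have hβ1 : β * ((R - r) ^ 2 - D) = 2 * (R - r) := by rw [hβ]; field_simp
  set n := ((R - r) ^ 2 - D) * ((R + r) ^ 2 - D) / 4 with hnn
  have hn0 : 0 < n := by positivity
  set κ := n * β ^ 2 - D - (R + r) ^ 2 with hκd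
  have hnβ : n * β = (R - r) * ((R + r) ^ 2 - D) / 2 := by
    rw [hnn]; linear_combination ((R + r) ^ 2 - D) / 4 * hβ1
  have hne' : ∀ i j, i ≠ j → ¬(1 / ρ i - β = 1 / ρ j - β ∧
      (a * y i - b * x i) * (1 / ρ i) = (a * y j - b * x j) * (1 / ρ j)) := by
    rintro i j hij ⟨h1, h2⟩
    have h3 : ρ i = ρ j := by simpa using h1
    have h4 : a * y i - b * x i = a * y j - b * x j := by
      rw [h3] at h2
      exact mul_right_cancel₀ (one_div_ne_zero (hρ j).ne') h2
    have h5 : a * x i + b * y i = a * x j + b * y j := by rw [hdot, hdot, h3]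
    refine hne i j hij ⟨mul_left_cancel₀ h0.ne' ?_, mul_left_cancel₀ h0.ne' ?_, h3⟩
    · linear_combination a * h5 - b * h4
    · linear_combination b * h5 + a * h4
  obtain ⟨hκ, e0, e1, hdev⟩ := quarter_turn (n := n) (s := fun i => 1 / ρ i - β)
    (Y := fun i => (a * y i - b * x i) * (1 / ρ i)) (σ := κ + 2 * D) (κ := κ) hn0
    (fun i => by
      have key : ((a * x i + b * y i) * (1 / ρ i)) ^ 2 + ((a * y i - b * x i) * (1 / ρ i)) ^ 2
          = D * (1 + r * (1 / ρ i)) ^ 2 := by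
        linear_combination (1 / ρ i) ^ 2 * D * hi i
          + D * (ρ i * (1 / ρ i) + 1 + 2 * r * (1 / ρ i)) * hc i
      rw [hX] at key
      linear_combination key - 2 * (1 / ρ i) * hnβ)
    (fun i => by
      have h2 : x i * x (i + 1) + y i * y (i + 1)
          = r ^ 2 + r * (ρ i + ρ (i + 1)) - ρ i * ρ (i + 1) := by
        linear_combination (hi i + hi (i + 1) - ht i) / 2
      have key : ((a * x i + b * y i) * (1 / ρ i))
            * ((a * x (i + 1) + b * y (i + 1)) * (1 / ρ (i + 1)))
          + ((a * y i - b * x i) * (1 / ρ i)) * ((a * y (i + 1) - b * x (i + 1)) * (1 / ρ (i + 1)))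
          = D * (r ^ 2 * (1 / ρ i) * (1 / ρ (i + 1)) + r * (1 / ρ i + 1 / ρ (i + 1)) - 1) := by
        linear_combination (1 / ρ i) * (1 / ρ (i + 1)) * D * h2
          + D * (r * (1 / ρ (i + 1)) - ρ (i + 1) * (1 / ρ (i + 1))) * hc i
          + D * (r * (1 / ρ i) - 1) * hc (i + 1)
      rw [hX, hX] at key
      linear_combination key - (1 / ρ i + 1 / ρ (i + 1)) * hnβ)
    (hne' 0 2 (by decide)) (hne' 1 3 (by decide))
  have hpe : D = pedoe R r := by
    -- Multiplying `κ = 0` by `(R - r) ^ 2 - D` clears the denominator of `β`.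
    have h1 : D * (D - pedoe R r) = 0 := by
      rw [hκd] at hκ
      rw [pedoe]
      linear_combination ((R - r) ^ 2 - D) * hκ - β * ((R - r) ^ 2 - D) * hnβ
        - (R - r) * ((R + r) ^ 2 - D) / 2 * hβ1
    linarith [(mul_eq_zero.1 h1).resolve_left h0.ne']
  have hβ2 : β = (R - r) / (2 * R * r) := by
    rw [hβ, hpe, pedoe, show (R - r) ^ 2 - (R ^ 2 - 6 * R * r + r ^ 2) = 4 * R * r by ring]
    field_simp
    ring
  have hβ3 : (R - r) / (R * r) = 2 * β := by rw [hβ2]; field_simp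
  refine ⟨hpe, hr, hrR, ?_, ?_, ?_⟩
  · rw [hβ3]; linarith
  · rw [hβ3]; linarith
  · rw [← hβ2, eq_div_iff (by positivity)]
    have hn2 : n = 8 * R ^ 2 * r ^ 2 := by
      rw [hnn, hpe, pedoe]; ring
    rw [hn2, hκ] at hdev
    rw [← hpe]
    linear_combination hdev / 2

/-! ### From poristic quadruples to chains -/

/-- The deviations of the curvatures of a poristic quadruple are the first coordinates of four unit
vectors, each obtained from its predecessor by a quarter turn. -/
lemma IsPoristicQuadruple.exists_angles {ρ : Fin 4 → ℝ} {R r : ℝ}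
    (h : IsPoristicQuadruple ρ R r) : ∃ c s : Fin 4 → ℝ,
      (∀ i, c i ^ 2 + s i ^ 2 = 1) ∧ (∀ i, c i * c (i + 1) + s i * s (i + 1) = 0) ∧
      (∀ i, c (i + 2) = -c i) ∧ (∀ i, s (i + 2) = -s i) ∧
      ∀ i, 1 / ρ i = (R - r + √(pedoe R r) * c i) / (2 * R * r) := by
  have hr := h.inner_pos
  have hR : 0 < R := hr.trans h.inner_lt_outer
  have hd := h.deviation
  have hsq := Real.sq_sqrt h.pedoe_nonneg
  have hd0 := Real.sqrt_nonneg (pedoe R r)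
  have h0 := h.opp_zero
  have h1 := h.opp_one
  rw [show (R - r) / (R * r) = 2 * ((R - r) / (2 * R * r)) by field_simp] at h0 h1
  simp only [add_div, mul_div_assoc √(pedoe R r)]
  rw [← hsq] at hd
  set d := √(pedoe R r)
  set β := (R - r) / (2 * R * r)
  obtain ⟨C, S, hCS, hC, hS⟩ : ∃ C S : ℝ, C ^ 2 + S ^ 2 = 1 ∧
      1 / ρ 0 = β + d * (C / (2 * R * r)) ∧ 1 / ρ 1 = β + d * (S / (2 * R * r)) := by
    rcases hd0.eq_or_lt with h | h
    · rw [← h] at hd ⊢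
      have hd' : (1 / ρ 0 - β) ^ 2 + (1 / ρ 1 - β) ^ 2 = 0 := by rw [hd]; simp
      -- For `d = 0` all curvatures equal `β`, and any unit vector serves.
      refine ⟨1, 0, by norm_num, ?_, ?_⟩ <;>
        nlinarith [sq_nonneg (1 / ρ 0 - β), sq_nonneg (1 / ρ 1 - β)]
    · refine ⟨2 * R * r * (1 / ρ 0 - β) / d, 2 * R * r * (1 / ρ 1 - β) / d, ?_, ?_, ?_⟩
      · rw [div_pow, div_pow, ← add_div, mul_pow, mul_pow _ (1 / ρ 1 - β), ← mul_add, hd]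
        field_simp
        norm_num
      · generalize 1 / ρ 0 = b
        field_simp
        ring
      · generalize 1 / ρ 1 = b
        field_simp
        ring
  refine ⟨![C, S, -C, -S], ![S, -C, -S, C], ?_, ?_, ?_, ?_, ?_⟩ <;> intro i <;> fin_cases i
  · exact hCS
  · change S ^ 2 + (-C) ^ 2 = 1; linear_combination hCS
  · change (-C) ^ 2 + (-S) ^ 2 = 1; linear_combination hCS
  · change (-S) ^ 2 + C ^ 2 = 1; linear_combination hCS
  · change C * S + S * -C = 0; ring
  · change S * -C + -C * -S = 0; ring
  · change -C * -S + -S * C = 0; ring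
  · change -S * C + C * S = 0; ring
  · rfl
  · rfl
  · exact (neg_neg C).symm
  · exact (neg_neg S).symm
  · rfl
  · exact (neg_neg C).symm
  · exact (neg_neg S).symm
  · rfl
  · exact hC
  · exact hS
  · change 1 / ρ 2 = β + d * (-C / (2 * R * r))
    linear_combination h0 - hC
  · change 1 / ρ 3 = β + d * (-S / (2 * R * r))
    linear_combination h1 - hS

/-- The centres come from solving the relations of the eccentric case with `a = d`, `b = 0` and
cancelling `d`; the resulting formulas remain valid for `d = 0`. -/
lemma IsPoristicQuadruple.exists_chainCoordinates {ρ : Fin 4 → ℝ} (hρ : ∀ i, 0 < ρ i) {R r : ℝ}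
    (h : IsPoristicQuadruple ρ R r) :
    ∃ x y : Fin 4 → ℝ, IsChainCoordinates ρ x y R r √(pedoe R r) 0 := by
  obtain ⟨c, s, hcs, horth, hc2, hs2, hc⟩ := h.exists_angles
  have hr := h.inner_pos
  have hrR := h.inner_lt_outer
  have hR : 0 < R := hr.trans hrR
  have hsq := Real.sq_sqrt h.pedoe_nonneg
  set d := √(pedoe R r)
  rw [pedoe] at hsq
  have hu : ∀ i, ρ i * (R - r + d * c i) = 2 * R * r := by
    intro i
    have h1 := hc i
    rw [div_eq_div_iff (hρ i).ne' (by positivity)] at h1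
    linarith
  have hru : ∀ i, ρ i + r = ρ i * (3 * R - r + d * c i) / (2 * R) := by
    intro i
    rw [eq_div_iff (by positivity)]
    linear_combination -hu i
  have h2 : √2 ^ 2 = (2 : ℝ) := Real.sq_sqrt (by norm_num)
  have hinner : ∀ i, (ρ i * (-d + (r - 3 * R) * c i) / (2 * R)) ^ 2 + (ρ i * (√2 * s i)) ^ 2
      = (ρ i + r) ^ 2 := by
    intro i
    rw [hru]
    field_simp
    rw [h2]
    linear_combination ρ i ^ 2 * ((1 - c i ^ 2) * hsq + 8 * R ^ 2 * hcs i)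
  have hnext : ∀ i, (ρ i * (-d + (r - 3 * R) * c i) / (2 * R)
        - ρ (i + 1) * (-d + (r - 3 * R) * c (i + 1)) / (2 * R)) ^ 2
      + (ρ i * (√2 * s i) - ρ (i + 1) * (√2 * s (i + 1))) ^ 2 = (ρ i + ρ (i + 1)) ^ 2 := by
    intro i
    have hdot : (ρ i * (-d + (r - 3 * R) * c i) / (2 * R))
          * (ρ (i + 1) * (-d + (r - 3 * R) * c (i + 1)) / (2 * R))
        + (ρ i * (√2 * s i)) * (ρ (i + 1) * (√2 * s (i + 1)))
        = (ρ i + r) * (ρ (i + 1) + r) - 2 * ρ i * ρ (i + 1) := by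
      rw [hru, hru]
      field_simp
      rw [h2]
      linear_combination ρ i * ρ (i + 1) * ((1 - c i * c (i + 1)) * hsq + 8 * R ^ 2 * horth i)
    linear_combination hinner i + hinner (i + 1) - 2 * hdot
  have hnext0 : ∀ i, ¬(ρ i * (-d + (r - 3 * R) * c i) / (2 * R)
      = ρ (i + 1) * (-d + (r - 3 * R) * c (i + 1)) / (2 * R) ∧
      ρ i * (√2 * s i) = ρ (i + 1) * (√2 * s (i + 1))) := by
    rintro i ⟨e1, e2⟩
    have h1 := hnext i
    rw [e1, e2, sub_self, sub_self] at h1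
    have h3 : 0 < (ρ i + ρ (i + 1)) ^ 2 := pow_pos (add_pos (hρ _) (hρ _)) 2
    linarith
  refine ⟨fun i => ρ i * (-d + (r - 3 * R) * c i) / (2 * R), fun i => ρ i * (√2 * s i),
    hr, hrR, ?_, hρ, hinner, ?_, hnext, ?_⟩
  · nlinarith [mul_pos hR hr]
  · intro i
    have hx : 2 * d * (ρ i * (-d + (r - 3 * R) * c i) / (2 * R))
        = 2 * (R + r) * ρ i + r ^ 2 - R ^ 2 + d ^ 2 := by
      field_simp
      linear_combination (r - 3 * R) * hu i - (ρ i + R) * hsq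
    linear_combination hinner i - hx
  · rintro i j hij ⟨e1, e2, e3⟩
    rcases (by decide : ∀ i j : Fin 4, i ≠ j → j = i + 1 ∨ i = j + 1 ∨ j = i + 2) i j hij
      with rfl | rfl | rfl
    · exact hnext0 i ⟨e1, e2⟩
    · exact hnext0 j ⟨e1.symm, e2.symm⟩
    -- Opposite circles have opposite unit vectors; coincidence would make these vanish.
    · simp only [hc2, hs2, ← e3] at e1 e2
      have hs0 : s i = 0 := by
        have := mul_left_cancel₀ (hρ i).ne' e2
        have h2' : √2 ≠ (0 : ℝ) := by positivity
        have := mul_left_cancel₀ h2' this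
        linarith
      have hc0 : c i = 0 := by
        rw [div_left_inj' (by positivity)] at e1
        have := mul_left_cancel₀ (hρ i).ne' e1
        have h3 : (3 * R - r) * c i = 0 := by linarith
        exact (mul_eq_zero.1 h3).resolve_left (by linarith)
      have := hcs i
      rw [hs0, hc0] at this
      norm_num at this

/-! ### Translation between coordinates and spheres -/

lemma Plane.dist_sq (p q : Plane) : dist p q ^ 2 = (p 0 - q 0) ^ 2 + (p 1 - q 1) ^ 2 := by
  rw [EuclideanSpace.dist_eq, Real.sq_sqrt (by positivity), Fin.sum_univ_two, Real.dist_eq,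
    Real.dist_eq, sq_abs, sq_abs]

lemma Plane.dist_eq_iff {p q : Plane} {l : ℝ} (hl : 0 ≤ l) :
    dist p q = l ↔ (p 0 - q 0) ^ 2 + (p 1 - q 1) ^ 2 = l ^ 2 := by
  rw [← Plane.dist_sq, sq_eq_sq₀ dist_nonneg hl]

/-- A circle of positive radius lies in an open disk if and only if the distance of the centres is
less than the difference of the radii. -/
lemma sphere_subset_ball_iff {γ Γ : Sphere Plane} (hγ : 0 < γ.radius) :
    (γ : Set Plane) ⊆ Metric.ball Γ.center Γ.radius ↔
      dist γ.center Γ.center < Γ.radius - γ.radius := by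
  constructor
  · intro h
    -- `v` points from the centre of `Γ` to that of `γ`, towards the farthest point of `γ`; in the
    -- concentric case any direction works.
    obtain ⟨v, hv, hd⟩ : ∃ v : Plane, ‖v‖ = 1 ∧
        γ.center - Γ.center = dist γ.center Γ.center • v := by
      by_cases h0 : γ.center = Γ.center
      · refine ⟨EuclideanSpace.single 0 1, by simp, by simp [h0]⟩
      · have h1 : γ.center - Γ.center ≠ 0 := sub_ne_zero.2 h0
        refine ⟨‖γ.center - Γ.center‖⁻¹ • (γ.center - Γ.center), norm_smul_inv_norm h1, ?_⟩
        rw [dist_eq_norm, smul_smul, mul_inv_cancel₀ (norm_ne_zero_iff.2 h1), one_smul]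
    have hmem : γ.center + γ.radius • v ∈ (γ : Set Plane) := by
      simp [norm_smul, hv, abs_of_pos hγ]
    have := h hmem
    rw [Metric.mem_ball, dist_eq_norm, add_sub_right_comm, hd, ← add_smul, norm_smul, hv, mul_one,
      Real.norm_of_nonneg (add_nonneg dist_nonneg hγ.le)] at this
    linarith
  · intro h p hp
    have hp' : dist p γ.center = γ.radius := hp
    rw [Metric.mem_ball]
    linarith [dist_triangle p γ.center Γ.center]

lemma IsSteinerChain.chainCoordinates {ρ : Fin 4 → ℝ} {γ Γ : Sphere Plane}
    {δ : Fin 4 → Sphere Plane} (h : IsSteinerChain γ Γ δ) (hδ : ∀ i, (δ i).radius = ρ i) :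
    IsChainCoordinates ρ (fun i => (δ i).center 0 - γ.center 0)
      (fun i => (δ i).center 1 - γ.center 1) Γ.radius γ.radius
      (Γ.center 0 - γ.center 0) (Γ.center 1 - γ.center 1) := by
  have hn := (sphere_subset_ball_iff h.inner_pos).1 h.nested
  have hd0 : 0 ≤ dist γ.center Γ.center := dist_nonneg
  refine ⟨h.inner_pos, by linarith, ?_, fun i => hδ i ▸ h.radius_pos i, ?_, ?_, ?_, ?_⟩
  · rw [← Plane.dist_sq, dist_comm]
    exact pow_lt_pow_left₀ hn hd0 two_ne_zero
  · intro i
    rw [← Plane.dist_sq, (h.tangent_inner i).dist_center, hδ]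
  · intro i
    rw [sub_sub_sub_cancel_right, sub_sub_sub_cancel_right, ← Plane.dist_sq,
      (h.tangent_outer i).dist_center, hδ]
  · intro i
    rw [sub_sub_sub_cancel_right, sub_sub_sub_cancel_right, ← Plane.dist_sq,
      (h.tangent_next i).dist_center, hδ, hδ]
  · rintro i j hij ⟨e1, e2, e3⟩
    refine hij (h.distinct (EuclideanGeometry.Sphere.ext ?_ (by rw [hδ, hδ, e3])))
    ext k
    fin_cases k
    · exact sub_left_injective e1
    · exact sub_left_injective e2

lemma IsChainCoordinates.exists_steinerChain {ρ x y : Fin 4 → ℝ} {R r a b : ℝ}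
    (h : IsChainCoordinates ρ x y R r a b) : ∃ (γ Γ : Sphere Plane) (δ : Fin 4 → Sphere Plane),
      IsSteinerChain γ Γ δ ∧ (∀ i, (δ i).radius = ρ i) ∧
      dist γ.center Γ.center ^ 2 = a ^ 2 + b ^ 2 := by
  have hr := h.inner_pos
  have hrR := h.inner_lt_outer
  have hu := h.radius_pos
  have hdist : dist (!₂[0, 0] : Plane) !₂[a, b] ^ 2 = a ^ 2 + b ^ 2 := by
    simp [Plane.dist_sq]
  -- The squared equation `outer` does not fix the sign of `R - ρ i`; the triangle inequality with
  -- `nested` does.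
  have hle : ∀ i, ρ i ≤ R := by
    intro i
    by_contra hlt
    rw [not_le] at hlt
    have h1 : dist (!₂[x i, y i] : Plane) !₂[0, 0] = ρ i + r := by
      rw [Plane.dist_eq_iff (by linarith [hu i])]
      simpa using h.inner i
    have h2 : dist (!₂[x i, y i] : Plane) !₂[a, b] = ρ i - R := by
      rw [Plane.dist_eq_iff (by linarith)]
      have := h.outer i
      simp only [Matrix.cons_val_zero, Matrix.cons_val_one]
      linear_combination this
    have h3 : dist (!₂[0, 0] : Plane) !₂[a, b] < R - r :=
      lt_of_pow_lt_pow_left₀ 2 (by linarith) (hdist ▸ h.nested)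
    have h4 := dist_triangle (!₂[x i, y i] : Plane) !₂[a, b] !₂[0, 0]
    rw [dist_comm (!₂[a, b] : Plane)] at h4
    linarith
  refine ⟨⟨!₂[0, 0], r⟩, ⟨!₂[a, b], R⟩, fun i => ⟨!₂[x i, y i], ρ i⟩, ⟨hr, ?_, hu, ?_, ?_, ?_, ?_⟩,
    fun _ => rfl, hdist⟩
  · rw [sphere_subset_ball_iff hr]
    exact lt_of_pow_lt_pow_left₀ 2 (by simpa using hrR.le) (hdist ▸ h.nested)
  · intro i j hij
    by_contra hne
    rw [EuclideanGeometry.Sphere.mk.injEq] at hij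
    exact h.distinct i j hne ⟨congrArg (fun p : Plane => p 0) hij.1,
      congrArg (fun p : Plane => p 1) hij.1, hij.2⟩
  · intro i
    rw [Sphere.isExtTangent_iff_dist_center]
    refine ⟨?_, (hu _).le, (hu _).le⟩
    rw [Plane.dist_eq_iff (by linarith [hu i, hu (i + 1)])]
    exact h.next i
  · intro i
    rw [Sphere.isExtTangent_iff_dist_center]
    refine ⟨?_, (hu _).le, hr.le⟩
    rw [Plane.dist_eq_iff (by linarith [hu i])]
    simpa using h.inner i
  · intro i
    rw [Sphere.isIntTangent_iff_dist_center]
    refine ⟨?_, (hu _).le, (hr.trans hrR).le⟩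
    rw [Plane.dist_eq_iff (by linarith [hle i])]
    exact h.outer i

/-- The radii of Steiner 4-chains with prescribed parent radii and distance of the parent centres
are the poristic quadruples. -/
lemma exists_steinerChain_iff {ρ : Fin 4 → ℝ} (hρ : ∀ i, 0 < ρ i) (P : ℝ → Prop) :
    (∃ (γ Γ : Sphere Plane) (δ : Fin 4 → Sphere Plane),
      IsSteinerChain γ Γ δ ∧ P (dist γ.center Γ.center ^ 2) ∧ ∀ i, (δ i).radius = ρ i) ↔
      ∃ R r : ℝ, IsPoristicQuadruple ρ R r ∧ P (pedoe R r) := by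
  constructor
  · rintro ⟨γ, Γ, δ, h, hP, hδ⟩
    have hc := h.chainCoordinates hδ
    rw [dist_comm, Plane.dist_sq] at hP
    rcases (add_nonneg (sq_nonneg (Γ.center 0 - γ.center 0))
      (sq_nonneg (Γ.center 1 - γ.center 1))).eq_or_lt with h0 | h0
    · obtain ⟨h1, h2⟩ := hc.concentric h0.symm
      exact ⟨_, _, h2, by rwa [h1, h0]⟩
    · obtain ⟨h1, h2⟩ := hc.eccentric h0
      exact ⟨_, _, h2, by rwa [← h1]⟩
  · rintro ⟨R, r, h, hP⟩
    obtain ⟨x, y, hc⟩ := h.exists_chainCoordinates hρ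
    obtain ⟨γ, Γ, δ, h1, h2, h3⟩ := hc.exists_steinerChain
    refine ⟨γ, Γ, δ, h1, ?_, h2⟩
    rw [h3, Real.sq_sqrt h.pedoe_nonneg]
    simpa using hP

theorem mainTheorem4 (ρ : Fin 4 → ℝ) (hρ : ∀ i, 0 < ρ i) (k : Fin 4) :
    ((∃ (γ Γ : Sphere Plane) (δ : Fin 4 → Sphere Plane),
        IsSteinerChain γ Γ δ ∧ γ.center ≠ Γ.center ∧ ∀ i, (δ i).radius = ρ i) ↔
      FeasibilityTest ρ k) ∧
    ((∃ (γ Γ : Sphere Plane) (δ : Fin 4 → Sphere Plane),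
        IsSteinerChain γ Γ δ ∧ ∀ i, (δ i).radius = ρ i) ↔
      FeasibilityTestWithConcentric ρ k) := by
  have hfeas : ∀ R r : ℝ, IsPoristicQuadruple ρ R r ↔
      IsVirtualRadii ρ R r ∧ PassesChecks ρ k R r := fun R r =>
    ⟨fun h => h.checks hρ k, fun h => isPoristicQuadruple_of_neighbours hρ h.1 h.2.neighbours⟩
  constructor
  · have hne : ∀ p q : Plane, p ≠ q ↔ 0 < dist p q ^ 2 := fun p q => by
      rw [← dist_pos, sq_pos_iff, dist_pos, dist_ne_zero]
    simp only [hne]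
    -- Positivity of `D` encodes distinct parent centres; the trivial predicate below admits
    -- concentric ones.
    rw [exists_steinerChain_iff hρ fun D => 0 < D, FeasibilityTest]
    simp only [hfeas]
    exact exists₂_congr fun R r => by tauto
  · have h1 := exists_steinerChain_iff hρ fun _ => True
    simp only [true_and, and_true] at h1
    rw [h1, FeasibilityTestWithConcentric]
    refine exists₂_congr fun R r => ⟨fun h => ?_, fun h => (hfeas R r).2 ⟨h.1, h.2.2⟩⟩
    have h2 := (hfeas R r).1 h
    exact ⟨h2.1, h.pedoe_nonneg, h2.2⟩
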